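/- Let the Heisenberg group $\mathbb{H}$ be $\mathbb{R}^3$, with coordinates $(x,y,z)$, endowed with the sub-Riemannian structure for which the vector fields $$X_1=\frac{\partial}{\partial x}-\frac y2\frac{\partial}{\partial z},\qquad X_2=\frac{\partial}{\partial y}+\frac x2\frac{\partial}{\partial z}$$ form an orthonormal frame of the horizontal distribution. Let $d_{\mathbb{H}}(p,q)$ be the infimum of the lengths of the horizontal curves from $p$ to $q$, that is, of the Lipschitz curves joining $p$ to $q$ that are almost everywhere tangent to the distribution. Let $T>0$ and let $\zeta=(x,y,z)\colon\,]-T,T[\,\to\mathbb{H}$ be a $C^\infty$ curve that is everywhere tangent to the distribution and parametrized by arc length. Define its characteristic deviation by $h_\zeta=\dot x\,\ddot y-\dot y\,\ddot x$ and its geodesic curvature by $k_\zeta=\dot h_\zeta$. Then there is a $C^\infty$ function $\theta\colon\,]-T,T[\,\to\mathbb{R}$ such that $\zeta'=\cos\theta\,X_1+\sin\theta\,X_2$, every such $\theta$ satisfies $k_\zeta=\ddot\theta$ on $]-T,T[$, and, as $t\to0$, $$d_{\mathbb{H}}^2(\zeta(0),\zeta(t))=t^2-\frac{k_\zeta(0)^2}{720}\,t^6+\mathcal{O}(t^7).$$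 -/

import Mathlib

open Set Filter Topology MeasureTheory Asymptotics
open scoped ContDiff NNReal

noncomputable section

namespace Heisenberg

/-- The underlying manifold `ℝ³` of the Heisenberg group, with coordinates `(x, y, z)`.
A tangent vector at any point is also written in the coordinate frame as an element of `ℝ³`. -/
abbrev Point : Type := ℝ × ℝ × ℝ

/-- The vector field `X₁ = ∂/∂x - (y/2) ∂/∂z`. -/
def X₁ (p : Point) : Point := (1, 0, -(p.2.1 / 2))

/-- The vector field `X₂ = ∂/∂y + (x/2) ∂/∂z`. -/
def X₂ (p : Point) : Point := (0, 1, p.1 / 2)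

/-- The horizontal plane at `p`, spanned by `X₁` and `X₂`. -/
def distribution (p : Point) : Submodule ℝ Point := Submodule.span ℝ {X₁ p, X₂ p}

/-- The norm of a horizontal vector for which `(X₁, X₂)` is an orthonormal frame. The coefficients
of a horizontal vector in this frame are its first two coordinates, see `horizNorm_frame`. -/
def horizNorm (v : Point) : ℝ := Real.sqrt (v.1 ^ 2 + v.2.1 ^ 2)

theorem horizNorm_frame (p : Point) (a b : ℝ) :
    horizNorm (a • X₁ p + b • X₂ p) = Real.sqrt (a ^ 2 + b ^ 2) := by
  simp [horizNorm, X₁, X₂]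

/-- Horizontal curves on `[a, b]`: Lipschitz curves that are almost everywhere tangent to the
distribution. (The velocity of a Lipschitz curve exists almost everywhere and is measurable and
bounded. Being Lipschitz does not depend on the choice of a norm on `ℝ³`.) -/
structure IsHorizontalCurve (γ : ℝ → Point) (a b : ℝ) : Prop where
  lipschitz : ∃ K : ℝ≥0, LipschitzOnWith K γ (Icc a b)
  tangent : ∀ᵐ t ∂(volume.restrict (Icc a b)), deriv γ t ∈ distribution (γ t)

/-- The length of a horizontal curve on `[a, b]`. -/
def length (γ : ℝ → Point) (a b : ℝ) : ℝ := ∫ t in a..b, horizNorm (deriv γ t)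

/-- The sub-Riemannian distance `d_ℍ(p, q)`: the infimum of the lengths of the horizontal curves
from `p` to `q`. -/
def dist (p q : Point) : ℝ :=
  sInf {ℓ : ℝ | ∃ (a b : ℝ) (γ : ℝ → Point),
    a ≤ b ∧ IsHorizontalCurve γ a b ∧ γ a = p ∧ γ b = q ∧ ℓ = length γ a b}

/-- `ζ` restricts to a smooth horizontal curve on `]-T, T[`, parametrized by arc length. -/
structure IsSmoothUnitSpeedHorizontal (ζ : ℝ → Point) (T : ℝ) : Prop where
  smooth : ContDiffOn ℝ ∞ ζ (Ioo (-T) T)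
  horizontal : ∀ t ∈ Ioo (-T) T, deriv ζ t ∈ distribution (ζ t)
  unit_speed : ∀ t ∈ Ioo (-T) T, horizNorm (deriv ζ t) = 1

/-- `θ` is a smooth function on `]-T, T[` with `ζ' = cos θ X₁ + sin θ X₂`. -/
structure IsAngle (ζ : ℝ → Point) (T : ℝ) (θ : ℝ → ℝ) : Prop where
  smooth : ContDiffOn ℝ ∞ θ (Ioo (-T) T)
  deriv_eq : ∀ t ∈ Ioo (-T) T,
    deriv ζ t = Real.cos (θ t) • X₁ (ζ t) + Real.sin (θ t) • X₂ (ζ t)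

/-- The characteristic deviation `h_ζ = x' y'' - y' x''`. -/
def charDeviation (ζ : ℝ → Point) (t : ℝ) : ℝ :=
  deriv (fun s => (ζ s).1) t * deriv (deriv fun s => (ζ s).2.1) t
    - deriv (fun s => (ζ s).2.1) t * deriv (deriv fun s => (ζ s).1) t

/-- The geodesic curvature `k_ζ = h_ζ'`. -/
def geodesicCurvature (ζ : ℝ → Point) (t : ℝ) : ℝ := deriv (charDeviation ζ) t

end Heisenberg

end

/-! A horizontal curve is the lift of its planar projection, and `vertical p q` is the signed area
between that projection and its chord. Hence `dist p q` is an isoperimetric quantity depending on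
the chord `c` and the area, normalised as `f * c ^ 2 / 12`; an arc of small curvature `κ` has `f`
close to `κ * c`.

For small `f` the distance is `c * (1 + f ^ 2 / 24 - f ^ 4 / 640)` up to `c * O(f ^ 6)`
(`abs_dist_sub_le`). The lower bound is a calibration: `potential` has horizontal gradient of norm
at most one in the relevant region and integrates to the required value
(`IsHorizontalCurve.lower_bound`). The upper bound is the length of the lift of a parabola, close
enough to the optimal arc to agree through order `f ^ 4` (`length_parabola_le`).

Along `ζ` the quantity `f` is `O(t)`, so the error in the squared distance is `O(t ^ 8)`. It remains
to expand chord and area from the jet of `θ'` at `0` (`exists_chord_area_jets`); every term through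
relative order four cancels except the one in `θ''(0) ^ 2`. -/

namespace Heisenberg

/-! ### Horizontal curves, length and calibrations. -/

theorem mem_distribution_iff {p v : Point} :
    v ∈ distribution p ↔ v.2.2 = (p.1 * v.2.1 - p.2.1 * v.1) / 2 := by
  rw [distribution, Submodule.mem_span_pair]
  constructor
  · rintro ⟨a, b, rfl⟩
    simp [X₁, X₂]
    ring
  · intro h
    refine ⟨v.1, v.2.1, ?_⟩
    ext
    · simp [X₁, X₂]
    · simp [X₁, X₂]
    · simp [X₁, X₂, h]
      ring

theorem horizNorm_nonneg (v : Point) : 0 ≤ horizNorm v := Real.sqrt_nonneg _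

theorem continuous_horizNorm : Continuous horizNorm := by
  unfold horizNorm
  fun_prop

theorem length_nonneg {γ : ℝ → Point} {a b : ℝ} (hab : a ≤ b) : 0 ≤ length γ a b :=
  intervalIntegral.integral_nonneg hab fun _ _ => horizNorm_nonneg _

theorem horizNorm_le (v : Point) : horizNorm v ≤ 2 * ‖v‖ := by
  have h1 : |v.1| ≤ ‖v‖ := norm_fst_le v
  have h2 : |v.2.1| ≤ ‖v‖ := (norm_fst_le v.2).trans (norm_snd_le v)
  refine Real.sqrt_le_iff.2 ⟨by positivity, ?_⟩
  nlinarith [sq_le_sq' (abs_le.1 h1).1 (abs_le.1 h1).2, sq_le_sq' (abs_le.1 h2).1 (abs_le.1 h2).2,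
    sq_nonneg ‖v‖]

namespace IsHorizontalCurve

variable {γ : ℝ → Point} {a b : ℝ}

theorem mono (h : IsHorizontalCurve γ a b) {c : ℝ} (hc : c ∈ Icc a b) :
    IsHorizontalCurve γ a c := by
  obtain ⟨K, hK⟩ := h.lipschitz
  have hs : Icc a c ⊆ Icc a b := Icc_subset_Icc_right hc.2
  exact ⟨⟨K, hK.mono hs⟩, ae_restrict_of_ae_restrict_of_subset hs h.tangent⟩

theorem intervalIntegrable_horizNorm (h : IsHorizontalCurve γ a b) (hab : a ≤ b) :
    IntervalIntegrable (fun t => horizNorm (deriv γ t)) volume a b := by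
  obtain ⟨K, hK⟩ := h.lipschitz
  rw [intervalIntegrable_iff_integrableOn_Ioo_of_le hab]
  refine Measure.integrableOn_of_bounded (M := 2 * K) (by simp) ?_ ?_
  · exact (continuous_horizNorm.measurable.comp (measurable_deriv γ)).aestronglyMeasurable
  · refine (ae_restrict_iff' measurableSet_Ioo).2 (Eventually.of_forall fun t ht => ?_)
    rw [Real.norm_of_nonneg (horizNorm_nonneg _)]
    have := norm_deriv_le_of_lipschitzOn (Icc_mem_nhds ht.1 ht.2) hK
    linarith [horizNorm_le (deriv γ t)]

theorem length_mono (h : IsHorizontalCurve γ a b) {c : ℝ} (hc : c ∈ Icc a b) :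
    length γ a c ≤ length γ a b := by
  have hi := h.intervalIntegrable_horizNorm (hc.1.trans hc.2)
  exact intervalIntegral.integral_mono_interval le_rfl hc.1 hc.2
    (Eventually.of_forall fun _ => horizNorm_nonneg _) hi

/-- A calibration bounds the length of a horizontal curve from below. -/
theorem sub_le_length (h : IsHorizontalCurve γ a b) (hab : a ≤ b) {Φ : Point → ℝ}
    (hΦ : ContDiff ℝ 1 Φ)
    (hle : ∀ t ∈ Icc a b, ∀ v ∈ distribution (γ t), HasDerivAt γ v t →
      ∃ r ≤ horizNorm v, HasDerivAt (fun s => Φ (γ s)) r t) :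
    Φ (γ b) - Φ (γ a) ≤ length γ a b := by
  obtain ⟨K, hK⟩ := h.lipschitz
  -- A `C¹` function is only locally Lipschitz; compactness of the image makes `Φ ∘ γ` Lipschitz,
  -- hence absolutely continuous, so the fundamental theorem of calculus applies.
  have hcomp : IsCompact (γ '' Icc a b) := isCompact_Icc.image_of_continuousOn hK.continuousOn
  obtain ⟨M, hM⟩ := LocallyLipschitzOn.exists_lipschitzOnWith_of_compact hcomp
    (hΦ.locallyLipschitz.locallyLipschitzOn (s := γ '' Icc a b))
  have hlip : LipschitzOnWith (M * K) (fun s => Φ (γ s)) (uIcc a b) := by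
    rw [uIcc_of_le hab]
    exact hM.comp hK (mapsTo_image _ _)
  have hac := hlip.absolutelyContinuousOnInterval
  rw [← hac.integral_deriv_eq_sub]
  refine intervalIntegral.integral_mono_ae_restrict hab hac.intervalIntegrable_deriv
    (h.intervalIntegrable_horizNorm hab) ?_
  have hend : ∀ᵐ t ∂(volume.restrict (Icc a b)), t ∈ Ioo a b := by
    rw [← restrict_Ioo_eq_restrict_Icc]
    exact ae_restrict_mem measurableSet_Ioo
  filter_upwards [h.tangent, hK.ae_differentiableWithinAt_real measurableSet_Icc, hend]
    with t ht hd hm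
  have hd' := (hd.differentiableAt (Icc_mem_nhds hm.1 hm.2)).hasDerivAt
  obtain ⟨r, hr, hr'⟩ := hle t (Ioo_subset_Icc_self hm) _ ht hd'
  rw [hr'.deriv]
  exact hr

end IsHorizontalCurve

theorem dist_le_length {γ : ℝ → Point} {a b : ℝ} (hab : a ≤ b) (h : IsHorizontalCurve γ a b) :
    dist (γ a) (γ b) ≤ length γ a b := by
  refine csInf_le ⟨0, ?_⟩ ⟨a, b, γ, hab, h, rfl, rfl, rfl⟩
  rintro _ ⟨a, b, γ, hab, -, -, -, rfl⟩
  exact length_nonneg hab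

theorem dist_nonneg (p q : Point) : 0 ≤ dist p q := by
  refine Real.sInf_nonneg ?_
  rintro _ ⟨a, b, γ, hab, -, -, -, rfl⟩
  exact length_nonneg hab

theorem dist_self (p : Point) : dist p p = 0 := by
  refine le_antisymm ?_ (dist_nonneg p p)
  have h : IsHorizontalCurve (fun _ => p) 0 0 :=
    ⟨⟨0, (LipschitzWith.const p).lipschitzOnWith⟩, by simp⟩
  simpa [length] using dist_le_length le_rfl h

/-! ### Coordinates adapted to a direction. -/

/-- First coordinate of `q` after moving `p` to the origin and rotating `(e₁, e₂)` to `(1, 0)`. -/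
def longitudinal (p : Point) (e₁ e₂ : ℝ) (q : Point) : ℝ :=
  (q.1 - p.1) * e₁ + (q.2.1 - p.2.1) * e₂

/-- Second coordinate of `q` after moving `p` to the origin and rotating `(e₁, e₂)` to `(1, 0)`. -/
def transversal (p : Point) (e₁ e₂ : ℝ) (q : Point) : ℝ :=
  -(q.1 - p.1) * e₂ + (q.2.1 - p.2.1) * e₁

/-- Vertical coordinate of `p⁻¹ q` for the Heisenberg group law. -/
noncomputable def vertical (p q : Point) : ℝ :=
  q.2.2 - p.2.2 - (p.1 * q.2.1 - p.2.1 * q.1) / 2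

section Frame

variable {γ : ℝ → Point} {t : ℝ} {v : Point} (p : Point) (e₁ e₂ : ℝ)

theorem hasDerivAt_fst (hv : HasDerivAt γ v t) : HasDerivAt (fun s => (γ s).1) v.1 t :=
  (ContinuousLinearMap.fst ℝ ℝ (ℝ × ℝ)).hasFDerivAt.comp_hasDerivAt t hv

theorem hasDerivAt_snd_fst (hv : HasDerivAt γ v t) : HasDerivAt (fun s => (γ s).2.1) v.2.1 t :=
  ((ContinuousLinearMap.fst ℝ ℝ ℝ).comp
    (ContinuousLinearMap.snd ℝ ℝ (ℝ × ℝ))).hasFDerivAt.comp_hasDerivAt t hv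

theorem hasDerivAt_snd_snd (hv : HasDerivAt γ v t) : HasDerivAt (fun s => (γ s).2.2) v.2.2 t :=
  ((ContinuousLinearMap.snd ℝ ℝ ℝ).comp
    (ContinuousLinearMap.snd ℝ ℝ (ℝ × ℝ))).hasFDerivAt.comp_hasDerivAt t hv

theorem hasDerivAt_longitudinal (hv : HasDerivAt γ v t) :
    HasDerivAt (fun s => longitudinal p e₁ e₂ (γ s)) (v.1 * e₁ + v.2.1 * e₂) t :=
  (((hasDerivAt_fst hv).sub_const _).mul_const _).add
    (((hasDerivAt_snd_fst hv).sub_const _).mul_const _)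

theorem hasDerivAt_transversal (hv : HasDerivAt γ v t) :
    HasDerivAt (fun s => transversal p e₁ e₂ (γ s)) (-v.1 * e₂ + v.2.1 * e₁) t :=
  (((hasDerivAt_fst hv).sub_const _).neg.mul_const _).add
    (((hasDerivAt_snd_fst hv).sub_const _).mul_const _)

theorem hasDerivAt_vertical (hv : HasDerivAt γ v t) (hd : v ∈ distribution (γ t)) :
    HasDerivAt (fun s => vertical p (γ s))
      ((((γ t).1 - p.1) * v.2.1 - ((γ t).2.1 - p.2.1) * v.1) / 2) t := by
  have h := ((hasDerivAt_snd_snd hv).sub_const p.2.2).sub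
    ((((hasDerivAt_snd_fst hv).const_mul p.1).sub
      ((hasDerivAt_fst hv).const_mul p.2.1)).div_const 2)
  refine h.congr_deriv ?_
  rw [mem_distribution_iff.1 hd]
  ring

end Frame

/-- The planar cross product is invariant under rotation. -/
theorem vertical_deriv_eq {p q v : Point} {e₁ e₂ : ℝ} (he : e₁ ^ 2 + e₂ ^ 2 = 1) :
    ((q.1 - p.1) * v.2.1 - (q.2.1 - p.2.1) * v.1) / 2 =
      (longitudinal p e₁ e₂ q * (-v.1 * e₂ + v.2.1 * e₁)
        - transversal p e₁ e₂ q * (v.1 * e₁ + v.2.1 * e₂)) / 2 := by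
  simp only [longitudinal, transversal]
  linear_combination (-((q.1 - p.1) * v.2.1 - (q.2.1 - p.2.1) * v.1) / 2) * he

theorem horizNorm_eq_frame {v : Point} {e₁ e₂ : ℝ} (he : e₁ ^ 2 + e₂ ^ 2 = 1) :
    horizNorm v = Real.sqrt ((v.1 * e₁ + v.2.1 * e₂) ^ 2 + (-v.1 * e₂ + v.2.1 * e₁) ^ 2) := by
  rw [horizNorm]
  congr 1
  linear_combination (-(v.1 ^ 2 + v.2.1 ^ 2)) * he

theorem mul_add_mul_le_sqrt {a b x y : ℝ} (h : a ^ 2 + b ^ 2 ≤ 1) :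
    a * x + b * y ≤ Real.sqrt (x ^ 2 + y ^ 2) := by
  refine Real.le_sqrt_of_sq_le ?_
  nlinarith [sq_nonneg (a * y - b * x), sq_nonneg x, sq_nonneg y]

/-! ### Lower bound by calibration. -/

/-- The potential whose horizontal gradient is close to the unit field tangent to the translates of
a circular arc of curvature `κ` with chord `c` in the direction `(e₁, e₂)`. -/
noncomputable def potential (p : Point) (e₁ e₂ c κ : ℝ) (q : Point) : ℝ :=
  (longitudinal p e₁ e₂ q - c / 2) - κ ^ 2 / 6 * (longitudinal p e₁ e₂ q - c / 2) ^ 3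
    - κ ^ 4 / 40 * (longitudinal p e₁ e₂ q - c / 2) ^ 5
    - κ ^ 6 / 7 * (longitudinal p e₁ e₂ q - c / 2) ^ 7
    + κ * (vertical p q + longitudinal p e₁ e₂ q * transversal p e₁ e₂ q / 2)
    - κ * c / 2 * transversal p e₁ e₂ q

theorem contDiff_potential (p : Point) (e₁ e₂ c κ : ℝ) :
    ContDiff ℝ 1 (potential p e₁ e₂ c κ) := by
  unfold potential longitudinal transversal vertical
  fun_prop

theorem contDiff_longitudinal (p : Point) (e₁ e₂ : ℝ) :
    ContDiff ℝ 1 (longitudinal p e₁ e₂) := by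
  unfold longitudinal
  fun_prop

/-- With `ξ`, `η` the longitudinal and transversal coordinates and `u = ξ - c / 2`, the area term
`vertical + ξ η / 2` has derivative `ξ η'`, so the last two terms of the potential contribute `κ u
η'`. An exact unit field would have `√(1 - κ² u²)` as its other component; a polynomial replaces it.
-/
theorem hasDerivAt_potential {γ : ℝ → Point} {t : ℝ} {v : Point} (p : Point) {e₁ e₂ : ℝ}
    (c κ : ℝ) (he : e₁ ^ 2 + e₂ ^ 2 = 1) (hv : HasDerivAt γ v t) (hd : v ∈ distribution (γ t)) :
    HasDerivAt (fun s => potential p e₁ e₂ c κ (γ s))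
      ((1 - κ ^ 2 / 2 * (longitudinal p e₁ e₂ (γ t) - c / 2) ^ 2
          - κ ^ 4 / 8 * (longitudinal p e₁ e₂ (γ t) - c / 2) ^ 4
          - κ ^ 6 * (longitudinal p e₁ e₂ (γ t) - c / 2) ^ 6) * (v.1 * e₁ + v.2.1 * e₂)
        + κ * (longitudinal p e₁ e₂ (γ t) - c / 2) * (-v.1 * e₂ + v.2.1 * e₁)) t := by
  have hl := hasDerivAt_longitudinal p e₁ e₂ hv
  have ht := hasDerivAt_transversal p e₁ e₂ hv
  have hz := hasDerivAt_vertical p hv hd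
  rw [vertical_deriv_eq he] at hz
  have hu := hl.sub_const (c / 2)
  have h := ((((hu.sub ((hu.pow 3).const_mul (κ ^ 2 / 6))).sub
    ((hu.pow 5).const_mul (κ ^ 4 / 40))).sub ((hu.pow 7).const_mul (κ ^ 6 / 7))).add
    ((hz.add ((hl.mul ht).div_const 2)).const_mul κ)).sub (ht.const_mul (κ * c / 2))
  refine h.congr_deriv ?_
  push_cast
  ring

/-- The Taylor polynomial of `√(1 - w)` with its cubic coefficient lowered from `-1/16` to `-1`, so
that it stays below the root on `[0, 1/4]`. -/
theorem approx_sqrt_sq_add_le {w : ℝ} (h0 : 0 ≤ w) (h1 : w ≤ 1 / 4) :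
    (1 - w / 2 - w ^ 2 / 8 - w ^ 3) ^ 2 + w ≤ 1 := by
  have h3 : 0 ≤ w ^ 3 := by positivity
  have : (1 - w / 2 - w ^ 2 / 8 - w ^ 3) ^ 2 + w
      = 1 - w ^ 3 * (15 / 8 - w - 17 / 64 * w - w ^ 2 / 4 + w / 4 - w ^ 3) := by ring
  have hw2 : w ^ 2 ≤ 1 / 16 := by nlinarith
  have hw3 : w ^ 3 ≤ 1 / 64 := by nlinarith
  rw [this]
  nlinarith [mul_nonneg h3 (show 0 ≤ 15 / 8 - w - 17 / 64 * w - w ^ 2 / 4 + w / 4 - w ^ 3 by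
    linarith)]

/-- Lower bound for the length of a horizontal curve in terms of the chord `c` of its projection
and the enclosed area `f * c ^ 2 / 12`. -/
theorem IsHorizontalCurve.lower_bound {γ : ℝ → Point} {a b : ℝ} (h : IsHorizontalCurve γ a b)
    (hab : a ≤ b) {e₁ e₂ c f : ℝ} (he : e₁ ^ 2 + e₂ ^ 2 = 1) (hc : 0 < c) (hf : |f| ≤ 1 / 5)
    (h₁ : (γ b).1 - (γ a).1 = c * e₁) (h₂ : (γ b).2.1 - (γ a).2.1 = c * e₂)
    (h₃ : vertical (γ a) (γ b) = f * c ^ 2 / 12) :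
    c * (1 + f ^ 2 / 24 - f ^ 4 / 640 - f ^ 6 / 448) ≤ length γ a b := by
  have hf2 : f ^ 2 ≤ 1 / 25 := by nlinarith [sq_abs f, abs_nonneg f]
  -- The claimed bound is below `2 * c`, so only curves shorter than that matter; they stay where
  -- the calibration is valid.
  rcases le_total (2 * c) (length γ a b) with hL | hL
  · refine le_trans ?_ hL
    nlinarith [show 0 ≤ f ^ 4 by positivity, show 0 ≤ f ^ 6 by positivity]
  set p := γ a with hp
  -- The coordinate `ξ` and its negative are themselves calibrations.
  have hξ : ∀ t ∈ Icc a b, |longitudinal p e₁ e₂ (γ t)| ≤ 2 * c := by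
    intro t ht
    have hlt := (h.length_mono ht).trans hL
    have hone : (1 : ℝ) ^ 2 + 0 ^ 2 ≤ 1 := by norm_num
    have hmone : (-1 : ℝ) ^ 2 + 0 ^ 2 ≤ 1 := by norm_num
    have key1 := (h.mono ht).sub_le_length ht.1 (contDiff_longitudinal p e₁ e₂)
      fun s _ v _ hv => ⟨_, by
        rw [horizNorm_eq_frame he]; simpa using mul_add_mul_le_sqrt hone,
        hasDerivAt_longitudinal p e₁ e₂ hv⟩
    have key2 := (h.mono ht).sub_le_length ht.1 (contDiff_longitudinal p e₁ e₂).neg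
      fun s _ v _ hv => ⟨_, by
        rw [horizNorm_eq_frame he]
        refine le_trans (le_of_eq ?_) (mul_add_mul_le_sqrt hmone)
        ring,
        (hasDerivAt_longitudinal p e₁ e₂ hv).neg⟩
    have h0 : longitudinal p e₁ e₂ (γ a) = 0 := by simp [longitudinal, hp]
    simp only [h0] at key1 key2
    rw [abs_le]
    constructor <;> linarith
  have key := h.sub_le_length hab (contDiff_potential p e₁ e₂ c (f / c)) ?_
  · refine le_trans (le_of_eq ?_) key
    have hl : longitudinal p e₁ e₂ (γ b) = c := by
      rw [longitudinal, h₁, h₂]; linear_combination c * he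
    have ht : transversal p e₁ e₂ (γ b) = 0 := by
      rw [transversal, h₁, h₂]; ring
    have hl0 : longitudinal p e₁ e₂ p = 0 := by simp [longitudinal]
    have ht0 : transversal p e₁ e₂ p = 0 := by simp [transversal]
    have hv0 : vertical p p = 0 := by simp [vertical]; ring
    rw [← hp, potential, potential, hl, ht, hl0, ht0, hv0, h₃]
    field_simp
    ring
  · intro t ht v hv hγ
    refine ⟨_, ?_, hasDerivAt_potential p c (f / c) he hγ hv⟩
    rw [horizNorm_eq_frame he]
    apply mul_add_mul_le_sqrt
    set u := longitudinal p e₁ e₂ (γ t) - c / 2 with hu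
    have hu1 : |u| ≤ 5 / 2 * c := by
      have := abs_le.1 (hξ t ht)
      rw [abs_le]
      constructor <;> linarith
    -- The threshold `1/5` for `f` is chosen for this: `1/5 * 5/2 = 1/2`.
    have hw : (f / c * u) ^ 2 ≤ 1 / 4 := by
      have : |f / c * u| ≤ 1 / 2 := by
        rw [abs_mul, abs_div, abs_of_pos hc, div_mul_eq_mul_div, div_le_iff₀ hc]
        calc |f| * |u| ≤ 1 / 5 * (5 / 2 * c) := by gcongr
          _ = 1 / 2 * c := by ring
      nlinarith [sq_abs (f / c * u), abs_nonneg (f / c * u)]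
    have := approx_sqrt_sq_add_le (sq_nonneg _) hw
    refine le_trans (le_of_eq ?_) this
    ring

/-- The cubic Taylor polynomial of `√(1 + w)`; its square exceeds `1 + w` by `w ^ 4` times a
positive quadratic. -/
theorem sqrt_one_add_le {w : ℝ} (hw : 0 ≤ w) :
    Real.sqrt (1 + w) ≤ 1 + w / 2 - w ^ 2 / 8 + w ^ 3 / 16 := by
  have h3 : 0 ≤ w ^ 3 := by positivity
  have h : 1 + w + w ^ 4 * (5 / 64 - w / 64 + w ^ 2 / 256)
      = (1 + w / 2 - w ^ 2 / 8 + w ^ 3 / 16) ^ 2 := by ring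
  rw [Real.sqrt_le_iff]
  constructor
  · nlinarith [mul_nonneg hw (sq_nonneg (w - 1))]
  · rw [← h]
    have : 0 ≤ 5 / 64 - w / 64 + w ^ 2 / 256 := by nlinarith [sq_nonneg (w - 2)]
    nlinarith [mul_nonneg (show 0 ≤ w ^ 4 by positivity) this]

end Heisenberg

/-! ### Upper bound by parabolas, and the distance estimate. -/

namespace Heisenberg

/-- The horizontal lift from `p` of a parabolic arc with chord `c` in the direction `(e₁, e₂)`. -/
noncomputable def parabola (p : Point) (e₁ e₂ c κ : ℝ) (s : ℝ) : Point :=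
  (p.1 + s * e₁ - κ * (s ^ 2 - c * s) / 2 * e₂,
    p.2.1 + s * e₂ + κ * (s ^ 2 - c * s) / 2 * e₁,
    p.2.2 + κ * s ^ 3 / 12
      + (p.1 * (s * e₂ + κ * (s ^ 2 - c * s) / 2 * e₁)
        - p.2.1 * (s * e₁ - κ * (s ^ 2 - c * s) / 2 * e₂)) / 2)

theorem hasDerivAt_parabola (p : Point) (e₁ e₂ c κ s : ℝ) :
    HasDerivAt (parabola p e₁ e₂ c κ)
      (e₁ - κ * (s - c / 2) * e₂, e₂ + κ * (s - c / 2) * e₁,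
        κ * s ^ 2 / 4 + (p.1 * (e₂ + κ * (s - c / 2) * e₁)
          - p.2.1 * (e₁ - κ * (s - c / 2) * e₂)) / 2) s := by
  have hid := hasDerivAt_id' s
  have hη : HasDerivAt (fun s => κ * (s ^ 2 - c * s) / 2) (κ * (s - c / 2)) s :=
    ((((hid.pow 2).sub (hid.const_mul c)).const_mul κ).div_const 2).congr_deriv (by
      push_cast; ring)
  have hx := (hid.mul_const e₁).sub (hη.mul_const e₂)
  have hy := (hid.mul_const e₂).add (hη.mul_const e₁)
  have hz := ((((hid.pow 3).const_mul κ).div_const 12).const_add p.2.2).add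
    (((hy.const_mul p.1).sub (hx.const_mul p.2.1)).div_const 2)
  have h := (hx.const_add p.1).prodMk ((hy.const_add p.2.1).prodMk hz)
  convert! h using 1
  · funext s
    simp only [parabola, Pi.sub_apply, Pi.add_apply, Pi.pow_apply]
    ext <;> simp <;> ring
  · ext <;> push_cast <;> ring

theorem isHorizontalCurve_parabola (p : Point) {e₁ e₂ : ℝ} (c κ : ℝ) (he : e₁ ^ 2 + e₂ ^ 2 = 1) :
    IsHorizontalCurve (parabola p e₁ e₂ c κ) 0 c where
  lipschitz := by
    have hd : ContDiff ℝ 1 (parabola p e₁ e₂ c κ) := by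
      unfold parabola
      fun_prop
    exact LocallyLipschitzOn.exists_lipschitzOnWith_of_compact isCompact_Icc
      hd.locallyLipschitz.locallyLipschitzOn
  tangent := by
    refine Eventually.of_forall fun s => ?_
    rw [(hasDerivAt_parabola p e₁ e₂ c κ s).deriv, mem_distribution_iff]
    simp only [parabola]
    linear_combination (-(κ * s ^ 2 / 4)) * he

theorem length_parabola_le (p : Point) {e₁ e₂ c : ℝ} (f : ℝ) (he : e₁ ^ 2 + e₂ ^ 2 = 1)
    (hc : 0 < c) :
    length (parabola p e₁ e₂ c (f / c)) 0 c
      ≤ c * (1 + f ^ 2 / 24 - f ^ 4 / 640 + f ^ 6 / 448) := by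
  have hspeed : ∀ s, horizNorm (deriv (parabola p e₁ e₂ c (f / c)) s)
      ≤ 1 + (f / c) ^ 2 / 2 * (s - c / 2) ^ 2 - (f / c) ^ 4 / 8 * (s - c / 2) ^ 4
        + (f / c) ^ 6 / 16 * (s - c / 2) ^ 6 := by
    intro s
    rw [(hasDerivAt_parabola p e₁ e₂ c (f / c) s).deriv, horizNorm]
    have h := sqrt_one_add_le (sq_nonneg (f / c * (s - c / 2)))
    convert h using 1
    · congr 1
      linear_combination (1 + (f / c * (s - c / 2)) ^ 2) * he
    · ring
  have hpoly : ∀ s, HasDerivAt (fun s => (s - c / 2) + (f / c) ^ 2 / 6 * (s - c / 2) ^ 3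
      - (f / c) ^ 4 / 40 * (s - c / 2) ^ 5 + (f / c) ^ 6 / 112 * (s - c / 2) ^ 7)
      (1 + (f / c) ^ 2 / 2 * (s - c / 2) ^ 2 - (f / c) ^ 4 / 8 * (s - c / 2) ^ 4
        + (f / c) ^ 6 / 16 * (s - c / 2) ^ 6) s := by
    intro s
    have hu := (hasDerivAt_id' s).sub_const (c / 2)
    refine (((hu.add ((hu.pow 3).const_mul ((f / c) ^ 2 / 6))).sub
      ((hu.pow 5).const_mul ((f / c) ^ 4 / 40))).add
      ((hu.pow 7).const_mul ((f / c) ^ 6 / 112))).congr_deriv ?_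
    push_cast
    ring
  have hcont : Continuous fun s : ℝ => 1 + (f / c) ^ 2 / 2 * (s - c / 2) ^ 2
      - (f / c) ^ 4 / 8 * (s - c / 2) ^ 4 + (f / c) ^ 6 / 16 * (s - c / 2) ^ 6 := by fun_prop
  calc length (parabola p e₁ e₂ c (f / c)) 0 c
      ≤ ∫ s in (0 : ℝ)..c, (1 + (f / c) ^ 2 / 2 * (s - c / 2) ^ 2
          - (f / c) ^ 4 / 8 * (s - c / 2) ^ 4 + (f / c) ^ 6 / 16 * (s - c / 2) ^ 6) :=
        intervalIntegral.integral_mono_on hc.le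
          ((isHorizontalCurve_parabola p c (f / c) he).intervalIntegrable_horizNorm hc.le)
          (hcont.intervalIntegrable _ _) fun s _ => hspeed s
    _ = c * (1 + f ^ 2 / 24 - f ^ 4 / 640 + f ^ 6 / 7168) := by
        rw [intervalIntegral.integral_eq_sub_of_hasDerivAt (fun s _ => hpoly s)
          (hcont.intervalIntegrable _ _)]
        field_simp
        ring
    -- The sixth order constant is weakened to match the lower bound.
    _ ≤ c * (1 + f ^ 2 / 24 - f ^ 4 / 640 + f ^ 6 / 448) := by
        have : 0 ≤ f ^ 6 := by positivity
        gcongr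
        norm_num

/-- The distance of two points in terms of the chord `c` and the enclosed area `f * c ^ 2 / 12`,
for small `f`. -/
theorem abs_dist_sub_le {p q : Point} {c f : ℝ} (hc : 0 < c) (hf : |f| ≤ 1 / 5)
    (hchord : (q.1 - p.1) ^ 2 + (q.2.1 - p.2.1) ^ 2 = c ^ 2)
    (harea : vertical p q = f * c ^ 2 / 12) :
    |dist p q - c * (1 + f ^ 2 / 24 - f ^ 4 / 640)| ≤ c * (f ^ 6 / 448) := by
  obtain ⟨e₁, h₁⟩ : ∃ e₁, q.1 - p.1 = c * e₁ := ⟨(q.1 - p.1) / c, by field_simp⟩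
  obtain ⟨e₂, h₂⟩ : ∃ e₂, q.2.1 - p.2.1 = c * e₂ := ⟨(q.2.1 - p.2.1) / c, by field_simp⟩
  have he : e₁ ^ 2 + e₂ ^ 2 = 1 := by
    rw [h₁, h₂] at hchord
    have : c ^ 2 * (e₁ ^ 2 + e₂ ^ 2) = c ^ 2 * 1 := by linarith
    exact mul_left_cancel₀ (by positivity) this
  have hcurve := isHorizontalCurve_parabola p c (f / c) he
  have hstart : parabola p e₁ e₂ c (f / c) 0 = p := by ext <;> simp [parabola]
  have hend : parabola p e₁ e₂ c (f / c) c = q := by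
    ext
    · simp only [parabola]
      linear_combination -h₁
    · simp only [parabola]
      linear_combination -h₂
    · simp only [parabola]
      rw [vertical] at harea
      have : f / c * c ^ 3 = f * c ^ 2 := by field_simp
      linear_combination -harea + this / 12 - p.1 * h₂ / 2 + p.2.1 * h₁ / 2
  have hle : dist p q ≤ length (parabola p e₁ e₂ c (f / c)) 0 c := by
    simpa only [hstart, hend] using dist_le_length hc.le hcurve
  have hge : c * (1 + f ^ 2 / 24 - f ^ 4 / 640 - f ^ 6 / 448) ≤ dist p q := by
    -- The parabola also shows that the set of lengths is nonempty.
    refine le_csInf ⟨_, 0, c, _, hc.le, hcurve, hstart, hend, rfl⟩ ?_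
    rintro _ ⟨a, b, γ, hab, hγ, rfl, rfl, rfl⟩
    exact hγ.lower_bound hab he hc hf h₁ h₂ harea
  have := length_parabola_le p f he hc
  rw [abs_le]
  constructor <;> linarith

theorem abs_dist_sq_sub_le {p q : Point} {c f : ℝ} (hc : 0 < c) (hf : |f| ≤ 1 / 5)
    (hchord : (q.1 - p.1) ^ 2 + (q.2.1 - p.2.1) ^ 2 = c ^ 2)
    (harea : vertical p q = f * c ^ 2 / 12) :
    |dist p q ^ 2 - c ^ 2 * (1 + f ^ 2 / 24 - f ^ 4 / 640) ^ 2| ≤ c ^ 2 * f ^ 6 := by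
  have h := abs_dist_sub_le hc hf hchord harea
  have hf2 : f ^ 2 ≤ 1 / 25 := by nlinarith [sq_abs f, abs_nonneg f]
  have h4 : 0 ≤ f ^ 4 := by positivity
  have h6 : 0 ≤ f ^ 6 := by positivity
  have h4' : f ^ 4 ≤ 1 := by nlinarith
  have h6' : f ^ 6 ≤ 1 := by nlinarith
  set M := 1 + f ^ 2 / 24 - f ^ 4 / 640 with hM
  have hM0 : 0 ≤ M := by nlinarith [sq_nonneg f]
  have hM2 : M ≤ 2 := by nlinarith
  have hd : dist p q ≤ 3 * c := by
    have := (abs_le.1 h).2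
    nlinarith
  have hd0 := dist_nonneg p q
  have hsum : |dist p q + c * M| ≤ 5 * c := by
    rw [abs_of_nonneg (by positivity)]
    nlinarith
  calc |dist p q ^ 2 - c ^ 2 * M ^ 2| = |dist p q - c * M| * |dist p q + c * M| := by
        rw [← abs_mul]; congr 1; ring
    _ ≤ (c * (f ^ 6 / 448)) * (5 * c) := by gcongr
    _ ≤ c ^ 2 * f ^ 6 := by nlinarith [mul_nonneg (sq_nonneg c) h6]

end Heisenberg

/-! ### Existence of the angle and the formula for the curvature. -/

/-- A smooth map to the unit circle on an open interval has a smooth angle. -/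
theorem exists_contDiffOn_angle {u v : ℝ → ℝ} {T : ℝ} (hT : 0 < T)
    (hu : ContDiffOn ℝ ∞ u (Ioo (-T) T)) (hv : ContDiffOn ℝ ∞ v (Ioo (-T) T))
    (huv : ∀ t ∈ Ioo (-T) T, u t ^ 2 + v t ^ 2 = 1) :
    ∃ θ : ℝ → ℝ, ContDiffOn ℝ ∞ θ (Ioo (-T) T) ∧
      ∀ t ∈ Ioo (-T) T, u t = Real.cos (θ t) ∧ v t = Real.sin (θ t) := by
  have h0 : (0 : ℝ) ∈ Ioo (-T) T := ⟨by linarith, hT⟩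
  obtain ⟨hud, hu'⟩ := (contDiffOn_infty_iff_deriv_of_isOpen isOpen_Ioo).1 hu
  obtain ⟨hvd, hv'⟩ := (contDiffOn_infty_iff_deriv_of_isOpen isOpen_Ioo).1 hv
  have hh : ContDiffOn ℝ ∞ (fun t => u t * deriv v t - v t * deriv u t) (Ioo (-T) T) :=
    (hu.mul hv').sub (hv.mul hu')
  set h := fun t => u t * deriv v t - v t * deriv u t with hh_def
  obtain ⟨α, hα⟩ : ∃ α : ℝ, u 0 = Real.cos α ∧ v 0 = Real.sin α := by
    have hz : ‖(⟨u 0, v 0⟩ : ℂ)‖ = 1 := by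
      rw [Complex.norm_def, Complex.normSq_mk, Real.sqrt_eq_one]
      linarith [huv 0 h0]
    refine ⟨Complex.arg ⟨u 0, v 0⟩, ?_, ?_⟩
    · rw [Complex.cos_arg (by rw [← norm_ne_zero_iff, hz]; exact one_ne_zero), hz, div_one]
    · rw [Complex.sin_arg, hz, div_one]
  have hθ : ∀ t ∈ Ioo (-T) T, HasDerivAt (fun t => α + ∫ s in (0 : ℝ)..t, h s) (h t) t := by
    intro t ht
    have hsub : uIcc 0 t ⊆ Ioo (-T) T := ordConnected_Ioo.uIcc_subset h0 ht
    refine (intervalIntegral.integral_hasDerivAt_right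
      (hh.continuousOn.mono hsub).intervalIntegrable ?_ ?_).const_add α
    · exact hh.continuousOn.stronglyMeasurableAtFilter isOpen_Ioo t ht
    · exact hh.continuousOn.continuousAt (isOpen_Ioo.mem_nhds ht)
  -- The angular velocity of `(u, v)` is integrated from an initial argument.
  set θ := fun t => α + ∫ s in (0 : ℝ)..t, h s with hθ_def
  refine ⟨θ, ?_, ?_⟩
  · refine (contDiffOn_infty_iff_deriv_of_isOpen isOpen_Ioo).2
      ⟨fun t ht => (hθ t ht).differentiableAt.differentiableWithinAt, ?_⟩
    exact hh.congr fun t ht => (hθ t ht).deriv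
  -- The inner product of `(u, v)` with `(cos θ, sin θ)` is constant and equals `1` at `0`; unit
  -- vectors with inner product `1` coincide.
  · have hA : ∀ t ∈ Ioo (-T) T,
        HasDerivAt (fun t => u t * Real.cos (θ t) + v t * Real.sin (θ t)) 0 t := by
      intro t ht
      have hut := (hud.differentiableAt (isOpen_Ioo.mem_nhds ht)).hasDerivAt
      have hvt := (hvd.differentiableAt (isOpen_Ioo.mem_nhds ht)).hasDerivAt
      have hsq : u t * deriv u t + v t * deriv v t = 0 := by
        have h1 : HasDerivAt (fun s => u s ^ 2 + v s ^ 2) 0 t :=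
          (hasDerivAt_const t (1 : ℝ)).congr_of_eventuallyEq
            (eventually_of_mem (isOpen_Ioo.mem_nhds ht) huv)
        have h2 := h1.unique ((hut.pow 2).add (hvt.pow 2))
        push_cast at h2
        linarith
      refine ((hut.mul (hθ t ht).cos).add (hvt.mul (hθ t ht).sin)).congr_deriv ?_
      simp only [hh_def]
      linear_combination (-deriv u t * Real.cos (θ t) - deriv v t * Real.sin (θ t)) * huv t ht
        + (u t * Real.cos (θ t) + v t * Real.sin (θ t)) * hsq
    have hconst : ∀ t ∈ Ioo (-T) T, u t * Real.cos (θ t) + v t * Real.sin (θ t) = 1 := by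
      intro t ht
      have hc := isOpen_Ioo.is_const_of_deriv_eq_zero isPreconnected_Ioo
        (fun t ht => (hA t ht).differentiableAt.differentiableWithinAt)
        (fun t ht => (hA t ht).deriv) ht h0
      have hθ0 : θ 0 = α := by simp [hθ_def]
      rw [hc, hθ0, ← hα.1, ← hα.2]
      linarith [huv 0 h0]
    intro t ht
    have key : (u t - Real.cos (θ t)) ^ 2 + (v t - Real.sin (θ t)) ^ 2 = 0 := by
      linear_combination huv t ht + Real.sin_sq_add_cos_sq (θ t) - 2 * hconst t ht
    constructor
    · nlinarith [sq_nonneg (u t - Real.cos (θ t)), sq_nonneg (v t - Real.sin (θ t))]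
    · nlinarith [sq_nonneg (u t - Real.cos (θ t)), sq_nonneg (v t - Real.sin (θ t))]

namespace Heisenberg

variable {ζ : ℝ → Point} {T : ℝ}

theorem IsSmoothUnitSpeedHorizontal.hasDerivAt (hζ : IsSmoothUnitSpeedHorizontal ζ T) {t : ℝ}
    (ht : t ∈ Ioo (-T) T) : HasDerivAt ζ (deriv ζ t) t :=
  ((hζ.smooth.differentiableOn (by simp)).differentiableAt (isOpen_Ioo.mem_nhds ht)).hasDerivAt

theorem IsSmoothUnitSpeedHorizontal.exists_isAngle (hT : 0 < T)
    (hζ : IsSmoothUnitSpeedHorizontal ζ T) : ∃ θ : ℝ → ℝ, IsAngle ζ T θ := by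
  have hd := ((contDiffOn_infty_iff_deriv_of_isOpen isOpen_Ioo).1 hζ.smooth).2
  have hu : ContDiffOn ℝ ∞ (fun t => (deriv ζ t).1) (Ioo (-T) T) := hd.fst
  have hv : ContDiffOn ℝ ∞ (fun t => (deriv ζ t).2.1) (Ioo (-T) T) := hd.snd.fst
  obtain ⟨θ, hθ, h⟩ := exists_contDiffOn_angle hT hu hv fun t ht => by
    simpa [horizNorm, Real.sqrt_eq_one] using hζ.unit_speed t ht
  refine ⟨θ, hθ, fun t ht => ?_⟩
  have hz := mem_distribution_iff.1 (hζ.horizontal t ht)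
  rw [← (h t ht).1, ← (h t ht).2]
  ext
  · simp [X₁, X₂]
  · simp [X₁, X₂]
  · simp [X₁, X₂, hz]
    ring

namespace IsAngle

variable {θ : ℝ → ℝ}

theorem deriv_fst (hζ : IsSmoothUnitSpeedHorizontal ζ T) (hθ : IsAngle ζ T θ) {t : ℝ}
    (ht : t ∈ Ioo (-T) T) : HasDerivAt (fun s => (ζ s).1) (Real.cos (θ t)) t := by
  have h := hasDerivAt_fst (hζ.hasDerivAt ht)
  rw [hθ.deriv_eq t ht] at h
  simpa [X₁, X₂] using h

theorem deriv_snd_fst (hζ : IsSmoothUnitSpeedHorizontal ζ T) (hθ : IsAngle ζ T θ) {t : ℝ}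
    (ht : t ∈ Ioo (-T) T) : HasDerivAt (fun s => (ζ s).2.1) (Real.sin (θ t)) t := by
  have h := hasDerivAt_snd_fst (hζ.hasDerivAt ht)
  rw [hθ.deriv_eq t ht] at h
  simpa [X₁, X₂] using h

theorem charDeviation_eq (hζ : IsSmoothUnitSpeedHorizontal ζ T) (hθ : IsAngle ζ T θ) {t : ℝ}
    (ht : t ∈ Ioo (-T) T) : charDeviation ζ t = deriv θ t := by
  have hI := isOpen_Ioo.mem_nhds ht
  have hθt := ((hθ.smooth.differentiableOn (by simp)).differentiableAt hI).hasDerivAt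
  have hx : deriv (fun s => (ζ s).1) =ᶠ[𝓝 t] fun s => Real.cos (θ s) :=
    eventually_of_mem hI fun s hs => (hθ.deriv_fst hζ hs).deriv
  have hy : deriv (fun s => (ζ s).2.1) =ᶠ[𝓝 t] fun s => Real.sin (θ s) :=
    eventually_of_mem hI fun s hs => (hθ.deriv_snd_fst hζ hs).deriv
  rw [charDeviation, hx.deriv_eq, hy.deriv_eq, hx.eq_of_nhds, hy.eq_of_nhds, hθt.cos.deriv,
    hθt.sin.deriv]
  linear_combination deriv θ t * Real.sin_sq_add_cos_sq (θ t)

theorem geodesicCurvature_eq (hζ : IsSmoothUnitSpeedHorizontal ζ T) (hθ : IsAngle ζ T θ)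
    {t : ℝ} (ht : t ∈ Ioo (-T) T) : geodesicCurvature ζ t = deriv (deriv θ) t :=
  EventuallyEq.deriv_eq
    (eventually_of_mem (isOpen_Ioo.mem_nhds ht) fun _ hs => hθ.charDeviation_eq hζ hs)

end IsAngle

end Heisenberg

/-! ### Calculus of fourth order jets. -/

/-- `f` has the fourth order expansion `c₀ + c₁ t + c₂ t ^ 2 + c₃ t ^ 3 + c₄ t ^ 4` at `0`. -/
def HasJet (f : ℝ → ℝ) (c₀ c₁ c₂ c₃ c₄ : ℝ) : Prop :=
  (fun t => f t - (c₀ + c₁ * t + c₂ * t ^ 2 + c₃ * t ^ 3 + c₄ * t ^ 4)) =O[𝓝[≠] 0]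
    (fun t : ℝ => t ^ 5)

theorem Continuous.isBigO_one_punctured {R : ℝ → ℝ} (hR : Continuous R) :
    R =O[𝓝[≠] 0] (fun _ => (1 : ℝ)) :=
  ((hR.tendsto 0).mono_left nhdsWithin_le_nhds).isBigO_one ℝ

theorem isBigO_punctured_pow_of_le {m n : ℕ} (h : m ≤ n) :
    (fun t : ℝ => t ^ n) =O[𝓝[≠] 0] (fun t : ℝ => t ^ m) := by
  refine IsBigO.of_bound 1 ?_
  filter_upwards [nhdsWithin_le_nhds (Metric.ball_mem_nhds (0 : ℝ) one_pos)] with t ht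
  rw [one_mul, norm_pow, norm_pow]
  exact pow_le_pow_of_le_one (norm_nonneg t) (by simpa using (Metric.mem_ball.1 ht).le) h

namespace HasJet

variable {f g : ℝ → ℝ} {p₀ p₁ p₂ p₃ p₄ q₀ q₁ q₂ q₃ q₄ : ℝ}

theorem coeff_congr (hf : HasJet f p₀ p₁ p₂ p₃ p₄) (h₀ : p₀ = q₀) (h₁ : p₁ = q₁) (h₂ : p₂ = q₂)
    (h₃ : p₃ = q₃) (h₄ : p₄ = q₄) : HasJet f q₀ q₁ q₂ q₃ q₄ := by
  subst h₀ h₁ h₂ h₃ h₄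
  exact hf

theorem fun_congr (hf : HasJet f p₀ p₁ p₂ p₃ p₄) (h : ∀ᶠ t in 𝓝[≠] 0, f t = g t) :
    HasJet g p₀ p₁ p₂ p₃ p₄ :=
  IsBigO.congr' hf (h.mono fun t ht => by simp only [ht]) EventuallyEq.rfl

theorem poly (c₀ c₁ c₂ c₃ c₄ : ℝ) :
    HasJet (fun t => c₀ + c₁ * t + c₂ * t ^ 2 + c₃ * t ^ 3 + c₄ * t ^ 4) c₀ c₁ c₂ c₃ c₄ := by
  simp only [HasJet, sub_self]
  exact isBigO_zero _ _

theorem const (c : ℝ) : HasJet (fun _ => c) c 0 0 0 0 :=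
  (poly c 0 0 0 0).fun_congr (Eventually.of_forall fun t => by ring)

theorem id : HasJet (fun t => t) 0 1 0 0 0 :=
  (poly 0 1 0 0 0).fun_congr (Eventually.of_forall fun t => by ring)

theorem add (hf : HasJet f p₀ p₁ p₂ p₃ p₄) (hg : HasJet g q₀ q₁ q₂ q₃ q₄) :
    HasJet (fun t => f t + g t) (p₀ + q₀) (p₁ + q₁) (p₂ + q₂) (p₃ + q₃) (p₄ + q₄) :=
  (IsBigO.add hf hg).congr_left fun t => by ring

theorem sub (hf : HasJet f p₀ p₁ p₂ p₃ p₄) (hg : HasJet g q₀ q₁ q₂ q₃ q₄) :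
    HasJet (fun t => f t - g t) (p₀ - q₀) (p₁ - q₁) (p₂ - q₂) (p₃ - q₃) (p₄ - q₄) :=
  (IsBigO.sub hf hg).congr_left fun t => by ring

theorem tendsto (hf : HasJet f p₀ p₁ p₂ p₃ p₄) : Tendsto f (𝓝[≠] 0) (𝓝 p₀) := by
  have hP : Tendsto (fun t : ℝ => p₀ + p₁ * t + p₂ * t ^ 2 + p₃ * t ^ 3 + p₄ * t ^ 4) (𝓝[≠] 0)
      (𝓝 p₀) := by
    have : Continuous fun t : ℝ => p₀ + p₁ * t + p₂ * t ^ 2 + p₃ * t ^ 3 + p₄ * t ^ 4 := by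
      fun_prop
    simpa using (this.tendsto 0).mono_left nhdsWithin_le_nhds
  have h5 : Tendsto (fun t : ℝ => t ^ 5) (𝓝[≠] 0) (𝓝 0) := by
    simpa using ((continuous_pow 5).tendsto (0 : ℝ)).mono_left nhdsWithin_le_nhds
  simpa using (IsBigO.trans_tendsto hf h5).add hP

theorem isBigO_one (hf : HasJet f p₀ p₁ p₂ p₃ p₄) : f =O[𝓝[≠] 0] (fun _ => (1 : ℝ)) :=
  hf.tendsto.isBigO_one ℝ

theorem mul (hf : HasJet f p₀ p₁ p₂ p₃ p₄) (hg : HasJet g q₀ q₁ q₂ q₃ q₄) :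
    HasJet (fun t => f t * g t) (p₀ * q₀) (p₀ * q₁ + p₁ * q₀) (p₀ * q₂ + p₁ * q₁ + p₂ * q₀)
      (p₀ * q₃ + p₁ * q₂ + p₂ * q₁ + p₃ * q₀)
      (p₀ * q₄ + p₁ * q₃ + p₂ * q₂ + p₃ * q₁ + p₄ * q₀) := by
  have h1 := IsBigO.mul hf hg.isBigO_one
  have h2 := (poly p₀ p₁ p₂ p₃ p₄).isBigO_one.mul hg
  have hR : Continuous fun t : ℝ => (p₁ * q₄ + p₂ * q₃ + p₃ * q₂ + p₄ * q₁)
      + (p₂ * q₄ + p₃ * q₃ + p₄ * q₂) * t + (p₃ * q₄ + p₄ * q₃) * t ^ 2 + p₄ * q₄ * t ^ 3 := by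
    fun_prop
  have h3 := (isBigO_refl (fun t : ℝ => t ^ 5) (𝓝[≠] 0)).mul hR.isBigO_one_punctured
  simp only [mul_one, one_mul] at h1 h2 h3
  exact ((h1.add h2).add h3).congr_left fun t => by ring

/-- The product of `f` with the candidate jet is `1 + O(t ^ 5)`, and `1 / f` is bounded near `0`. -/
theorem inv (hf : HasJet f 1 0 p₂ p₃ p₄) :
    HasJet (fun t => (f t)⁻¹) 1 0 (-p₂) (-p₃) (p₂ ^ 2 - p₄) := by
  have h1 := (hf.mul (poly 1 0 (-p₂) (-p₃) (p₂ ^ 2 - p₄))).coeff_congr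
    (q₀ := 1) (q₁ := 0) (q₂ := 0) (q₃ := 0) (q₄ := 0)
    (by ring) (by ring) (by ring) (by ring) (by ring)
  have h2 := ((hf.tendsto.inv₀ one_ne_zero).isBigO_one ℝ).mul h1
  simp only [one_mul] at h2
  refine h2.neg_left.congr' ?_ EventuallyEq.rfl
  filter_upwards [hf.tendsto.eventually_ne one_ne_zero] with t ht
  field_simp
  ring

end HasJet

/-- Integration improves a bound by one order. -/
theorem isBigO_pow_succ_of_deriv {f f' : ℝ → ℝ} {n : ℕ}
    (hf : ∀ᶠ t in 𝓝 0, HasDerivAt f (f' t) t) (h0 : f 0 = 0)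
    (h : f' =O[𝓝[≠] 0] (fun t : ℝ => t ^ n)) : f =O[𝓝[≠] 0] (fun t : ℝ => t ^ (n + 1)) := by
  obtain ⟨C, hC⟩ := h.bound
  obtain ⟨ε, hε, hball⟩ :=
    Metric.eventually_nhds_iff_ball.1 (hf.and (eventually_nhdsWithin_iff.1 hC))
  refine IsBigO.of_bound C ?_
  filter_upwards [nhdsWithin_le_nhds (Metric.ball_mem_nhds (0 : ℝ) hε), self_mem_nhdsWithin]
    with t ht ht0
  rw [mem_compl_singleton_iff] at ht0
  simp only [Metric.mem_ball, dist_zero_right, Real.norm_eq_abs] at ht hball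
  -- Mean value theorem: the intermediate point is never `0`, so the punctured bound on `f'` applies
  -- there.
  have key : ∃ s, |s| ≤ |t| ∧ s ≠ 0 ∧ f t = f' s * t := by
    rcases lt_or_gt_of_ne ht0 with hneg | hpos
    · have hin : ∀ s ∈ Icc t 0, |s| ≤ |t| := fun s hs => by
        rw [abs_of_nonpos hs.2, abs_of_neg hneg]; linarith [hs.1]
      obtain ⟨s, hs, hs'⟩ := exists_hasDerivAt_eq_slope f f' hneg
        (fun s hs => (hball s ((hin s hs).trans_lt ht)).1.continuousAt.continuousWithinAt)
        (fun s hs => (hball s ((hin s (Ioo_subset_Icc_self hs)).trans_lt ht)).1)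
      refine ⟨s, hin s (Ioo_subset_Icc_self hs), hs.2.ne, ?_⟩
      rw [hs', h0]
      field_simp
      ring
    · have hin : ∀ s ∈ Icc 0 t, |s| ≤ |t| := fun s hs => by
        rw [abs_of_nonneg hs.1, abs_of_pos hpos]; exact hs.2
      obtain ⟨s, hs, hs'⟩ := exists_hasDerivAt_eq_slope f f' hpos
        (fun s hs => (hball s ((hin s hs).trans_lt ht)).1.continuousAt.continuousWithinAt)
        (fun s hs => (hball s ((hin s (Ioo_subset_Icc_self hs)).trans_lt ht)).1)
      refine ⟨s, hin s (Ioo_subset_Icc_self hs), hs.1.ne', ?_⟩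
      rw [hs', h0]
      field_simp
      ring
  obtain ⟨s, hst, hs0, hs⟩ := key
  have hb := (hball s (hst.trans_lt ht)).2 hs0
  have hC0 : 0 ≤ C := by
    rw [abs_pow] at hb
    by_contra hlt
    have : 0 < |s| ^ n := by positivity
    nlinarith [abs_nonneg (f' s)]
  rw [hs, Real.norm_eq_abs, Real.norm_eq_abs, abs_mul, abs_pow, pow_succ, ← mul_assoc]
  rw [abs_pow] at hb
  have : |f' s| ≤ C * |t| ^ n := hb.trans (by gcongr)
  gcongr

/-- The jet of a primitive, divided by the appropriate power of the variable. -/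
theorem HasJet.integrate {f f' s : ℝ → ℝ} {c₀ c₁ c₂ c₃ c₄ : ℝ} (j : ℕ)
    (hs : HasJet s c₀ c₁ c₂ c₃ c₄) (hf : ∀ᶠ t in 𝓝 0, HasDerivAt f (f' t) t) (h0 : f 0 = 0)
    (hf' : ∀ᶠ t in 𝓝[≠] 0, f' t = t ^ j * s t) :
    HasJet (fun t => f t / t ^ (j + 1)) (c₀ / (j + 1)) (c₁ / (j + 2)) (c₂ / (j + 3))
      (c₃ / (j + 4)) (c₄ / (j + 5)) := by
  have hP : ∀ t : ℝ, HasDerivAt (fun t : ℝ => c₀ / (j + 1) * t ^ (j + 1)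
      + c₁ / (j + 2) * t ^ (j + 2) + c₂ / (j + 3) * t ^ (j + 3) + c₃ / (j + 4) * t ^ (j + 4)
      + c₄ / (j + 5) * t ^ (j + 5))
      (t ^ j * (c₀ + c₁ * t + c₂ * t ^ 2 + c₃ * t ^ 3 + c₄ * t ^ 4)) t := by
    intro t
    have h := (((((hasDerivAt_pow (j + 1) t).const_mul (c₀ / (j + 1))).add
      ((hasDerivAt_pow (j + 2) t).const_mul (c₁ / (j + 2)))).add
      ((hasDerivAt_pow (j + 3) t).const_mul (c₂ / (j + 3)))).add
      ((hasDerivAt_pow (j + 4) t).const_mul (c₃ / (j + 4)))).add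
      ((hasDerivAt_pow (j + 5) t).const_mul (c₄ / (j + 5)))
    refine h.congr_deriv ?_
    push_cast
    have e1 : (j : ℝ) + 1 ≠ 0 := by positivity
    have e2 : (j : ℝ) + 2 ≠ 0 := by positivity
    have e3 : (j : ℝ) + 3 ≠ 0 := by positivity
    have e4 : (j : ℝ) + 4 ≠ 0 := by positivity
    have e5 : (j : ℝ) + 5 ≠ 0 := by positivity
    field_simp
    ring
  have hder : ∀ᶠ t in 𝓝 0, HasDerivAt (fun t => f t - (c₀ / (j + 1) * t ^ (j + 1)
      + c₁ / (j + 2) * t ^ (j + 2) + c₂ / (j + 3) * t ^ (j + 3) + c₃ / (j + 4) * t ^ (j + 4)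
      + c₄ / (j + 5) * t ^ (j + 5)))
      (f' t - t ^ j * (c₀ + c₁ * t + c₂ * t ^ 2 + c₃ * t ^ 3 + c₄ * t ^ 4)) t :=
    hf.mono fun t ht => ht.sub (hP t)
  have hO := isBigO_pow_succ_of_deriv (n := j + 5) hder (by simp [h0]) <| by
    refine (((isBigO_refl (fun t : ℝ => t ^ j) (𝓝[≠] 0)).mul hs).congr' ?_
      (Eventually.of_forall fun t => (pow_add t j 5).symm))
    filter_upwards [hf'] with t ht
    rw [ht]
    ring
  refine (hO.mul (isBigO_refl (fun t : ℝ => (t ^ (j + 1))⁻¹) _)).congr' ?_ ?_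
  · filter_upwards [self_mem_nhdsWithin] with t (ht : t ≠ 0)
    field_simp
    ring
  · filter_upwards [self_mem_nhdsWithin] with t (ht : t ≠ 0)
    field_simp
    ring

/-- Jets live on the punctured neighbourhood because quotients such as `f t / t` take the value `0`
at `0`; this returns to a full neighbourhood. -/
theorem isBigO_nhds_of_punctured {f : ℝ → ℝ} {n : ℕ} (h0 : f 0 = 0)
    (h : f =O[𝓝[≠] 0] (fun t : ℝ => t ^ n)) : f =O[𝓝 0] (fun t : ℝ => t ^ n) := by
  rw [← pure_sup_nhdsNE, isBigO_sup]
  exact ⟨by rw [isBigO_pure]; intro _; exact h0, h⟩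

theorem Real.cos_sub_isBigO :
    (fun x : ℝ => Real.cos x - (1 - x ^ 2 / 2 + x ^ 4 / 24)) =O[𝓝 0] (fun x => x ^ 6) := by
  refine isBigO_nhds_of_punctured (by simp) (isBigO_pow_succ_of_deriv (n := 5)
    (f' := fun x => -(Real.sin x - (x - x ^ 3 / 6))) (Eventually.of_forall fun x => ?_)
    (by simp) ?_)
  · have hid := hasDerivAt_id' x
    refine ((Real.hasDerivAt_cos x).sub (((((hid.pow 2).div_const 2).const_sub 1).add
      ((hid.pow 4).div_const 24)))).congr_deriv ?_
    push_cast
    ring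
  · refine IsBigO.of_bound (1 / 100) ?_
    filter_upwards [nhdsWithin_le_nhds (Metric.ball_mem_nhds (0 : ℝ) one_pos)] with x hx
    have := Real.sin_bound (x := x) (by simpa using (Metric.mem_ball.1 hx).le)
    rw [norm_neg, Real.norm_eq_abs, norm_pow, Real.norm_eq_abs]
    linarith

theorem Real.sin_sub_isBigO :
    (fun x : ℝ => Real.sin x - (x - x ^ 3 / 6 + x ^ 5 / 120)) =O[𝓝 0] (fun x => x ^ 7) := by
  refine isBigO_nhds_of_punctured (by simp) (isBigO_pow_succ_of_deriv (n := 6)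
    (Eventually.of_forall fun x => ?_) (by simp)
    (Real.cos_sub_isBigO.mono nhdsWithin_le_nhds))
  have hid := hasDerivAt_id' x
  refine ((Real.hasDerivAt_sin x).sub ((hid.sub ((hid.pow 3).div_const 6)).add
    ((hid.pow 5).div_const 120))).congr_deriv ?_
  push_cast
  ring

/-- A function which is smooth near `0` has a jet at `0`. -/
theorem exists_hasJet {h : ℝ → ℝ} {T : ℝ} (hT : 0 < T) (hh : ContDiffOn ℝ ∞ h (Ioo (-T) T)) :
    ∃ c₂ c₃ c₄, HasJet h (h 0) (deriv h 0) c₂ c₃ c₄ := by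
  have hI : Ioo (-T) T ∈ 𝓝 (0 : ℝ) := Ioo_mem_nhds (by linarith) hT
  have hd : ∀ {f : ℝ → ℝ}, ContDiffOn ℝ ∞ f (Ioo (-T) T) →
      ContDiffOn ℝ ∞ (deriv f) (Ioo (-T) T) ∧ ∀ᶠ t in 𝓝 0, HasDerivAt f (deriv f t) t := by
    intro f hf
    obtain ⟨h1, h2⟩ := (contDiffOn_infty_iff_deriv_of_isOpen isOpen_Ioo).1 hf
    exact ⟨h2, eventually_of_mem hI fun t ht =>
      (h1.differentiableAt (isOpen_Ioo.mem_nhds ht)).hasDerivAt⟩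
  obtain ⟨s1, d0⟩ := hd hh
  obtain ⟨s2, d1⟩ := hd s1
  obtain ⟨s3, d2⟩ := hd s2
  obtain ⟨s4, d3⟩ := hd s3
  obtain ⟨-, d4⟩ := hd s4
  set h1 := deriv h
  set h2 := deriv h1
  set h3 := deriv h2
  set h4 := deriv h3
  -- Differentiability of the fourth derivative gives a first order bound, which four integrations
  -- raise to order five.
  have o4 : (fun t => h4 t - h4 0) =O[𝓝[≠] 0] (fun t : ℝ => t ^ 1) := by
    simpa using d4.self_of_nhds.differentiableAt.isBigO_sub.mono nhdsWithin_le_nhds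
  have o3 := isBigO_pow_succ_of_deriv (f := fun t => h3 t - (h3 0 + h4 0 * t))
    (d3.mono fun t ht => (ht.sub
      (((hasDerivAt_id' t).const_mul (h4 0)).const_add (h3 0))).congr_deriv
        (by ring)) (by simp) o4
  have o2 := isBigO_pow_succ_of_deriv (f := fun t => h2 t - (h2 0 + (h3 0 * t + h4 0 / 2 * t ^ 2)))
    (d2.mono fun t ht => (ht.sub ((((hasDerivAt_id' t).const_mul (h3 0)).add
      (((hasDerivAt_id' t).pow 2).const_mul (h4 0 / 2))).const_add (h2 0))).congr_deriv
        (by push_cast; ring)) (by simp) o3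
  have o1 := isBigO_pow_succ_of_deriv
    (f := fun t => h1 t - (h1 0 + (h2 0 * t + h3 0 / 2 * t ^ 2 + h4 0 / 6 * t ^ 3)))
    (d1.mono fun t ht => (ht.sub (((((hasDerivAt_id' t).const_mul (h2 0)).add
      (((hasDerivAt_id' t).pow 2).const_mul (h3 0 / 2))).add
      (((hasDerivAt_id' t).pow 3).const_mul (h4 0 / 6))).const_add (h1 0))).congr_deriv
        (by push_cast; ring)) (by simp) o2
  have o0 := isBigO_pow_succ_of_deriv
    (f := fun t => h t
      - (h 0 + (h1 0 * t + h2 0 / 2 * t ^ 2 + h3 0 / 6 * t ^ 3 + h4 0 / 24 * t ^ 4)))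
    (d0.mono fun t ht => (ht.sub ((((((hasDerivAt_id' t).const_mul (h1 0)).add
      (((hasDerivAt_id' t).pow 2).const_mul (h2 0 / 2))).add
      (((hasDerivAt_id' t).pow 3).const_mul (h3 0 / 6))).add
      (((hasDerivAt_id' t).pow 4).const_mul (h4 0 / 24))).const_add (h 0))).congr_deriv
        (by push_cast; ring)) (by simp) o1
  exact ⟨h2 0 / 2, h3 0 / 6, h4 0 / 24, o0.congr_left fun t => by ring⟩

namespace HasJet

variable {f g ψ σ : ℝ → ℝ} {s₀ s₁ s₂ s₃ s₄ : ℝ}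

theorem of_sub_isBigO (hf : HasJet f s₀ s₁ s₂ s₃ s₄)
    (h : (fun t => g t - f t) =O[𝓝[≠] 0] (fun t : ℝ => t ^ 5)) : HasJet g s₀ s₁ s₂ s₃ s₄ :=
  (IsBigO.add h hf).congr_left fun t => by ring

theorem isBigO_id_of_mul (hσ : HasJet σ s₀ s₁ s₂ s₃ s₄)
    (h : ∀ᶠ t in 𝓝[≠] 0, ψ t = t * σ t) : ψ =O[𝓝[≠] 0] (fun t : ℝ => t) := by
  have h1 := (isBigO_refl (fun t : ℝ => t) (𝓝[≠] 0)).mul hσ.isBigO_one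
  simp only [mul_one] at h1
  exact h1.congr' (h.mono fun t ht => ht.symm) EventuallyEq.rfl

theorem tendsto_zero_of_mul (hσ : HasJet σ s₀ s₁ s₂ s₃ s₄)
    (h : ∀ᶠ t in 𝓝[≠] 0, ψ t = t * σ t) : Tendsto ψ (𝓝[≠] 0) (𝓝 0) :=
  (hσ.isBigO_id_of_mul h).trans_tendsto nhdsWithin_le_nhds

theorem cos_comp (hσ : HasJet σ s₀ s₁ s₂ s₃ s₄) (h : ∀ᶠ t in 𝓝[≠] 0, ψ t = t * σ t) :
    HasJet (fun t => Real.cos (ψ t)) 1 0 (-s₀ ^ 2 / 2) (-s₀ * s₁)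
      (-(s₁ ^ 2 + 2 * s₀ * s₂) / 2 + s₀ ^ 4 / 24) := by
  have hψ2 := (HasJet.id.mul hσ).mul (HasJet.id.mul hσ)
  have hpoly := ((HasJet.const 1).sub ((HasJet.const (1 / 2)).mul hψ2)).add
    ((HasJet.const (1 / 24)).mul (hψ2.mul hψ2))
  refine of_sub_isBigO (hpoly.coeff_congr (by ring) (by ring) (by ring) (by ring) (by ring)) ?_
  have hO := (Real.cos_sub_isBigO.comp_tendsto (hσ.tendsto_zero_of_mul h)).trans
    ((hσ.isBigO_id_of_mul h).pow 6)
  refine (hO.trans (isBigO_punctured_pow_of_le (m := 5) (by norm_num))).congr' ?_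
    EventuallyEq.rfl
  filter_upwards [h] with t ht
  simp only [Function.comp_apply, ht]
  ring

/-- Division by `t` costs one order, so the quintic term of the sine is needed here. -/
theorem sin_comp_div (hσ : HasJet σ s₀ s₁ s₂ s₃ s₄) (h : ∀ᶠ t in 𝓝[≠] 0, ψ t = t * σ t) :
    HasJet (fun t => Real.sin (ψ t) / t) s₀ s₁ (s₂ - s₀ ^ 3 / 6) (s₃ - s₀ ^ 2 * s₁ / 2)
      (s₄ - (s₀ ^ 2 * s₂ + s₀ * s₁ ^ 2) / 2 + s₀ ^ 5 / 120) := by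
  have hψ2 := (HasJet.id.mul hσ).mul (HasJet.id.mul hσ)
  have hpoly := hσ.mul (((HasJet.const 1).sub ((HasJet.const (1 / 6)).mul hψ2)).add
    ((HasJet.const (1 / 120)).mul (hψ2.mul hψ2)))
  refine of_sub_isBigO (hpoly.coeff_congr (by ring) (by ring) (by ring) (by ring) (by ring)) ?_
  have hO := ((Real.sin_sub_isBigO.comp_tendsto (hσ.tendsto_zero_of_mul h)).trans
    ((hσ.isBigO_id_of_mul h).pow 7)).mul (isBigO_refl (fun t : ℝ => t⁻¹) (𝓝[≠] 0))
  have h6 : (fun t : ℝ => t ^ 7 * t⁻¹) =O[𝓝[≠] 0] (fun t : ℝ => t ^ 5) := by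
    refine (isBigO_punctured_pow_of_le (m := 5) (n := 6) (by norm_num)).congr' ?_
      EventuallyEq.rfl
    filter_upwards [self_mem_nhdsWithin] with t (ht : t ≠ 0)
    field_simp
  refine (hO.trans h6).congr' ?_ EventuallyEq.rfl
  filter_upwards [h, self_mem_nhdsWithin] with t ht (ht0 : t ≠ 0)
  simp only [Function.comp_apply, ht]
  field_simp

end HasJet

/-! ### Expansion of chord and area. -/

/-- Expansion of the squared chord and of the swept area of the planar unit speed curve `(ξ, η)`
with angle `ψ`: the chord is `|t| √g` and twelve times the area is `t F` times the squared
chord. -/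
theorem exists_chord_area_jets {ψ ψ' ξ η A : ℝ → ℝ} {a k c₂ c₃ c₄ : ℝ}
    (hψ' : HasJet ψ' a k c₂ c₃ c₄)
    (hψ : ∀ᶠ t in 𝓝 0, HasDerivAt ψ (ψ' t) t) (hψ0 : ψ 0 = 0)
    (hξ : ∀ᶠ t in 𝓝 0, HasDerivAt ξ (Real.cos (ψ t)) t) (hξ0 : ξ 0 = 0)
    (hη : ∀ᶠ t in 𝓝 0, HasDerivAt η (Real.sin (ψ t)) t) (hη0 : η 0 = 0)
    (hA : ∀ᶠ t in 𝓝 0,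
      HasDerivAt A ((ξ t * Real.sin (ψ t) - η t * Real.cos (ψ t)) / 2) t) (hA0 : A 0 = 0) :
    ∃ g F : ℝ → ℝ,
      (∀ t, t ≠ 0 → ξ t ^ 2 + η t ^ 2 = t ^ 2 * g t) ∧
      (∀ᶠ t in 𝓝[≠] 0, A t = t * F t * (t ^ 2 * g t) / 12) ∧
      Tendsto g (𝓝[≠] 0) (𝓝 1) ∧ Tendsto F (𝓝[≠] 0) (𝓝 a) ∧
      HasJet (fun t => g t * (1 + (t * F t) ^ 2 / 24 - (t * F t) ^ 4 / 640) ^ 2)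
        1 0 0 0 (-k ^ 2 / 720) := by
  set σ : ℝ → ℝ := fun t => ψ t / t with hσ_def
  have hσ : HasJet σ a (k / 2) (c₂ / 3) (c₃ / 4) (c₄ / 5) := by
    have h := hψ'.integrate 0 hψ hψ0 (Eventually.of_forall fun t => by simp)
    simpa using h
  generalize c₂ / 3 = m at hσ
  generalize c₃ / 4 = m₃ at hσ
  generalize c₄ / 5 = m₄ at hσ
  obtain ⟨b, rfl⟩ : ∃ b, k = 2 * b := ⟨k / 2, by ring⟩
  rw [mul_div_cancel_left₀ b two_ne_zero] at hσ
  have hψσ : ∀ᶠ t in 𝓝[≠] 0, ψ t = t * σ t := by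
    filter_upwards [self_mem_nhdsWithin] with t (ht : t ≠ 0)
    rw [hσ_def]
    field_simp
  have hC := hσ.cos_comp hψσ
  have hS := hσ.sin_comp_div hψσ
  set S : ℝ → ℝ := fun t => Real.sin (ψ t) / t with hS_def
  -- These coefficients do not affect the result: `Y` enters the chord as `(t Y) ^ 2`, and the area
  -- is needed only to relative order two because `F` enters as `(t F) ^ 2`.
  generalize m₃ - a ^ 2 * b / 2 = r₃ at hS
  generalize m₄ - (a ^ 2 * m + a * b ^ 2) / 2 + a ^ 5 / 120 = r₄ at hS
  have hX : HasJet (fun t => ξ t / t ^ 1) 1 0 (-a ^ 2 / 6) (-a * b / 4)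
      ((-(b ^ 2 + 2 * a * m) / 2 + a ^ 4 / 24) / 5) :=
    (hC.integrate 0 hξ hξ0 (Eventually.of_forall fun t => by simp)).coeff_congr
      (by simp) (by simp) (by push_cast; ring) (by push_cast; ring) (by push_cast; ring)
  have hY : HasJet (fun t => η t / t ^ 2) (a / 2) (b / 3) ((m - a ^ 3 / 6) / 4) (r₃ / 5)
      (r₄ / 6) :=
    (hS.integrate 1 hη hη0 (by
      filter_upwards [self_mem_nhdsWithin] with t (ht : t ≠ 0)
      rw [hS_def]
      field_simp)).coeff_congr
      (by push_cast; ring) (by push_cast; ring) (by push_cast; ring) (by push_cast; ring)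
      (by push_cast; ring)
  set X : ℝ → ℝ := fun t => ξ t / t ^ 1 with hX_def
  set Y : ℝ → ℝ := fun t => η t / t ^ 2 with hY_def
  have hW' := (HasJet.const (1 / 2)).mul ((hX.mul hS).sub (hY.mul hC))
  obtain ⟨w₃, w₄, hW⟩ : ∃ w₃ w₄, HasJet (fun t => A t / t ^ 3) (a / 12) (b / 12)
      (3 * m / 40 - a ^ 3 / 240) w₃ w₄ := by
    refine ⟨_, _, (hW'.integrate 2 hA hA0 ?_).coeff_congr (by push_cast; ring)
      (by push_cast; ring) (by push_cast; ring) rfl rfl⟩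
    filter_upwards [self_mem_nhdsWithin] with t (ht : t ≠ 0)
    rw [hX_def, hY_def, hS_def]
    field_simp
  have hg : HasJet (fun t => X t * X t + t * Y t * (t * Y t)) 1 0 (-a ^ 2 / 12) (-a * b / 6)
      (a ^ 4 / 36 + (-(b ^ 2 + 2 * a * m) + a ^ 4 / 12) / 5 + b ^ 2 / 9
        + a * (m - a ^ 3 / 6) / 4) :=
    ((hX.mul hX).add ((HasJet.id.mul hY).mul (HasJet.id.mul hY))).coeff_congr
      (by ring) (by ring) (by ring) (by ring) (by ring)
  set g : ℝ → ℝ := fun t => X t * X t + t * Y t * (t * Y t) with hg_def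
  obtain ⟨f₃, f₄, hF⟩ : ∃ f₃ f₄, HasJet (fun t => 12 * (A t / t ^ 3 * (g t)⁻¹)) a b
      (9 * m / 10 - a ^ 3 / 20 + a ^ 3 / 12) f₃ f₄ :=
    ⟨_, _, ((HasJet.const 12).mul (hW.mul hg.inv)).coeff_congr (by ring) (by ring) (by ring)
      rfl rfl⟩
  refine ⟨g, fun t => 12 * (A t / t ^ 3 * (g t)⁻¹), ?_, ?_, hg.tendsto, hF.tendsto, ?_⟩
  · intro t ht
    rw [hg_def, hX_def, hY_def]
    field_simp
  · filter_upwards [self_mem_nhdsWithin, hg.tendsto.eventually_ne one_ne_zero]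
      with t (ht : t ≠ 0) hgt
    field_simp
  · set F : ℝ → ℝ := fun t => 12 * (A t / t ^ 3 * (g t)⁻¹) with hF_def
    have hF2 : HasJet (fun t => t * F t * (t * F t)) 0 0 (a ^ 2) (2 * a * b)
        (b ^ 2 + 2 * a * (9 * m / 10 - a ^ 3 / 20 + a ^ 3 / 12)) :=
      ((HasJet.id.mul hF).mul (HasJet.id.mul hF)).coeff_congr
        (by ring) (by ring) (by ring) (by ring) (by ring)
    have hM := ((HasJet.const 1).add ((HasJet.const (1 / 24)).mul hF2)).sub
      ((HasJet.const (1 / 640)).mul (hF2.mul hF2))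
    -- At order four the terms in `a ^ 4` and `a * m` cancel, while `b ^ 2` gets `-1/5 + 1/9 + 1/12
    -- = -1/180`, which is `-k ^ 2 / 720` since `k = 2 * b`.
    refine ((hg.mul (hM.mul hM)).fun_congr (Eventually.of_forall fun t => by ring)).coeff_congr
      (by ring) (by ring) (by ring) (by ring) (by ring)

/-! ### Conclusion for the curve `ζ`. -/

namespace Heisenberg

variable {ζ : ℝ → Point} {T : ℝ}

theorem IsAngle.dist_sq_isBigO (hT : 0 < T) (hζ : IsSmoothUnitSpeedHorizontal ζ T)
    {θ : ℝ → ℝ} (hθ : IsAngle ζ T θ) :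
    (fun t : ℝ => dist (ζ 0) (ζ t) ^ 2 - (t ^ 2 - deriv (deriv θ) 0 ^ 2 / 720 * t ^ 6))
      =O[𝓝 0] (fun t : ℝ => t ^ 7) := by
  refine isBigO_nhds_of_punctured (by simp [dist_self]) ?_
  have hI : Ioo (-T) T ∈ 𝓝 (0 : ℝ) := Ioo_mem_nhds (by linarith) hT
  have hθ' := (contDiffOn_infty_iff_deriv_of_isOpen isOpen_Ioo).1 hθ.smooth
  obtain ⟨c₂, c₃, c₄, hjet⟩ := exists_hasJet hT hθ'.2
  -- The frame is aligned with the initial velocity, so the planar angle becomes `θ t - θ 0` and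
  -- vanishes at `0`.
  set e₁ := Real.cos (θ 0) with he₁
  set e₂ := Real.sin (θ 0) with he₂
  have he : e₁ ^ 2 + e₂ ^ 2 = 1 := by
    rw [he₁, he₂, add_comm]; exact Real.sin_sq_add_cos_sq _
  have hfst : ∀ t ∈ Ioo (-T) T, (deriv ζ t).1 = Real.cos (θ t) := fun t ht =>
    (hasDerivAt_fst (hζ.hasDerivAt ht)).unique (hθ.deriv_fst hζ ht)
  have hsnd : ∀ t ∈ Ioo (-T) T, (deriv ζ t).2.1 = Real.sin (θ t) := fun t ht =>
    (hasDerivAt_snd_fst (hζ.hasDerivAt ht)).unique (hθ.deriv_snd_fst hζ ht)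
  obtain ⟨g, F, hchord, harea, hg, hF, hN⟩ := exists_chord_area_jets
    (ψ := fun t => θ t - θ 0) (ξ := fun t => longitudinal (ζ 0) e₁ e₂ (ζ t))
    (η := fun t => transversal (ζ 0) e₁ e₂ (ζ t)) (A := fun t => vertical (ζ 0) (ζ t)) hjet
    (eventually_of_mem hI fun t ht =>
      (hθ'.1.differentiableAt (isOpen_Ioo.mem_nhds ht)).hasDerivAt.sub_const _) (by simp)
    (eventually_of_mem hI fun t ht =>
      (hasDerivAt_longitudinal (ζ 0) e₁ e₂ (hζ.hasDerivAt ht)).congr_deriv (by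
        rw [hfst t ht, hsnd t ht, Real.cos_sub])) (by simp [longitudinal])
    (eventually_of_mem hI fun t ht =>
      (hasDerivAt_transversal (ζ 0) e₁ e₂ (hζ.hasDerivAt ht)).congr_deriv (by
        rw [hfst t ht, hsnd t ht, Real.sin_sub]; ring)) (by simp [transversal])
    (eventually_of_mem hI fun t ht =>
      (hasDerivAt_vertical (ζ 0) (hζ.hasDerivAt ht) (hζ.horizontal t ht)).congr_deriv (by
        rw [vertical_deriv_eq he, hfst t ht, hsnd t ht, Real.cos_sub, Real.sin_sub]
        ring)) (by simp [vertical]; ring)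
  have ht2 : Tendsto (fun t => t * F t) (𝓝[≠] 0) (𝓝 0) := by
    simpa using (tendsto_id.mono_left nhdsWithin_le_nhds).mul hF
  have hdist : (fun t => dist (ζ 0) (ζ t) ^ 2
      - t ^ 2 * (g t * (1 + (t * F t) ^ 2 / 24 - (t * F t) ^ 4 / 640) ^ 2))
      =O[𝓝[≠] 0] (fun t : ℝ => t ^ 8) := by
    have hbd := ((isBigO_refl (fun t : ℝ => t ^ 8) (𝓝[≠] 0)).mul (hg.isBigO_one ℝ)).mul
      ((hF.isBigO_one ℝ).pow 6)
    simp only [mul_one, one_pow] at hbd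
    refine IsBigO.trans (IsBigO.of_bound 1 ?_) hbd
    filter_upwards [self_mem_nhdsWithin, harea, hg.eventually (lt_mem_nhds one_pos),
      ht2.eventually (Metric.ball_mem_nhds 0 (show (0 : ℝ) < 1 / 5 by norm_num))]
      with t (ht0 : t ≠ 0) hA hgt hft
    -- The absolute value keeps the chord positive for `t` of either sign; the sign of the area is
    -- carried by `f = t * F t`.
    have hc2 : (|t| * Real.sqrt (g t)) ^ 2 = t ^ 2 * g t := by
      rw [mul_pow, sq_abs, Real.sq_sqrt hgt.le]
    have hmain := abs_dist_sq_sub_le (p := ζ 0) (q := ζ t) (c := |t| * Real.sqrt (g t))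
      (f := t * F t) (by positivity) (by simpa using (Metric.mem_ball.1 hft).le)
      (by
        rw [hc2, ← hchord t ht0, longitudinal, transversal]
        linear_combination (-(((ζ t).1 - (ζ 0).1) ^ 2 + ((ζ t).2.1 - (ζ 0).2.1) ^ 2)) * he)
      (by rw [hc2, hA])
    rw [hc2] at hmain
    have hpos : 0 ≤ t ^ 8 * g t * F t ^ 6 := by positivity
    rw [one_mul, Real.norm_eq_abs, Real.norm_of_nonneg hpos, ← mul_assoc]
    refine hmain.trans (le_of_eq ?_)
    ring
  have h2 := (isBigO_refl (fun t : ℝ => t ^ 2) (𝓝[≠] 0)).mul hN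
  simp only [← pow_add] at h2
  refine ((hdist.trans (isBigO_punctured_pow_of_le (by norm_num))).add h2).congr_left
    fun t => ?_
  ring

end Heisenberg

theorem mainTheorem1 (T : ℝ) (hT : 0 < T) (ζ : ℝ → Heisenberg.Point)
    (hζ : Heisenberg.IsSmoothUnitSpeedHorizontal ζ T) :
    (∃ θ : ℝ → ℝ, Heisenberg.IsAngle ζ T θ) ∧
    (∀ θ : ℝ → ℝ, Heisenberg.IsAngle ζ T θ →
      ∀ t ∈ Ioo (-T) T, Heisenberg.geodesicCurvature ζ t = deriv (deriv θ) t) ∧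
    (fun t : ℝ => Heisenberg.dist (ζ 0) (ζ t) ^ 2
        - (t ^ 2 - Heisenberg.geodesicCurvature ζ 0 ^ 2 / 720 * t ^ 6))
      =O[𝓝 0] (fun t : ℝ => t ^ 7) := by
  obtain ⟨θ, hθ⟩ := hζ.exists_isAngle hT
  refine ⟨⟨θ, hθ⟩, fun θ hθ t ht => hθ.geodesicCurvature_eq hζ ht, ?_⟩
  rw [hθ.geodesicCurvature_eq hζ ⟨by linarith, hT⟩]
  exact hθ.dist_sq_isBigO hT hζ
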